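/- Let $N\ge 3$, $n\ge 2$, let $\Omega\subset\mathbb R^N$ be an open set and let $a_1,\dots,a_n\in\Omega$ be pairwise distinct points. Put $$V(x)=\sum_{1\le i<j\le n}\frac{|a_i-a_j|^2}{|x-a_i|^2\,|x-a_j|^2},\qquad \mu^\star(\Omega)=\inf_{u\in D^{1,2}_0(\Omega),\ u\ne 0}\ \frac{\int_\Omega|\nabla u|^2\,dx}{\int_\Omega V u^2\,dx},$$ where $D^{1,2}_0(\Omega)$ is the completion of $C_c^\infty(\Omega)$ with respect to the norm $\left(\int_\Omega|\nabla u|^2\,dx\right)^{1/2}$ (a space of functions in $L^{2N/(N-2)}(\Omega)$ with weak gradient in $L^2(\Omega)$; it equals $H^1_0(\Omega)$ if $\Omega$ is bounded). (i) If $n=2$, then $\mu^\star(\Omega)=\dfrac{(N-2)^2}{4}$, whether $\Omega$ is bounded or not. (ii) If $n\ge 3$ and $\Omega$ is bounded, then $$\frac{(N-2)^2}{n^2}<\mu^\star(\Omega)\le\frac{(N-2)^2}{4n-4}.$$ -/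

import Mathlib

open MeasureTheory Filter Topology TopologicalSpace
open scoped ENNReal Distributions

noncomputable section

namespace MultipolarHardy

/-- The multi-singular potential
`V(x) = ∑_{i < j} |a_i - a_j|² / (|x - a_i|² |x - a_j|²)`. -/
def potential {N n : ℕ} (a : Fin n → EuclideanSpace ℝ (Fin N))
    (x : EuclideanSpace ℝ (Fin N)) : ℝ :=
  ∑ i, ∑ j ∈ Finset.Ioi i, ‖a i - a j‖ ^ 2 / (‖x - a i‖ ^ 2 * ‖x - a j‖ ^ 2)

/-- `G` is the weak gradient of `u` on the open set `Ω`: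
`∫_Ω u ∂_v ψ = - ∫_Ω ⟨G, v⟩ ψ` for all `ψ ∈ C_c^∞(Ω)` and all directions `v`. -/
def HasWeakGradient {N : ℕ} (Ω : Opens (EuclideanSpace ℝ (Fin N)))
    (u : EuclideanSpace ℝ (Fin N) → ℝ)
    (G : EuclideanSpace ℝ (Fin N) → EuclideanSpace ℝ (Fin N)) : Prop :=
  ∀ (ψ : 𝓓(Ω, ℝ)) (v : EuclideanSpace ℝ (Fin N)),
    ∫ x in Ω, u x * fderiv ℝ ψ x v = - ∫ x in Ω, inner ℝ (G x) v * ψ x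

/-- The critical Sobolev exponent `2* = 2N / (N - 2)` (used for `N ≥ 3`). -/
def sobolevExponent (N : ℕ) : ℝ≥0∞ :=
  ENNReal.ofReal (2 * (N : ℝ) / ((N : ℝ) - 2))

/-- For `N ≥ 3`, `MemD12 Ω u G` says that `u` belongs to `D^{1,2}_0(Ω)`, the completion of
`C_c^∞(Ω)` with respect to the Dirichlet norm `‖∇φ‖_{L²(Ω)}`, and that `G` is its weak gradient.

By the Sobolev inequality a sequence in `C_c^∞(Ω)` that is Cauchy for the Dirichlet norm
converges in `L^{2*}(Ω)`, which identifies the completion with the set of those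
`u ∈ L^{2*}(Ω)` for which there are `φ_k ∈ C_c^∞(Ω)` with `∇φ_k → ∇u` in `L²(Ω)` and
`φ_k → u` in `L^{2*}(Ω)`. Only the values on `Ω` matter. -/
structure MemD12 {N : ℕ} (Ω : Opens (EuclideanSpace ℝ (Fin N)))
    (u : EuclideanSpace ℝ (Fin N) → ℝ)
    (G : EuclideanSpace ℝ (Fin N) → EuclideanSpace ℝ (Fin N)) : Prop where
  memLp : MemLp u (sobolevExponent N) (volume.restrict Ω)
  memLp_grad : MemLp G 2 (volume.restrict Ω)
  weakGradient : HasWeakGradient Ω u G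
  approx : ∃ φ : ℕ → 𝓓(Ω, ℝ),
    Tendsto (fun k => eLpNorm (fun x => φ k x - u x) (sobolevExponent N) (volume.restrict Ω))
      atTop (𝓝 0) ∧
    Tendsto (fun k => eLpNorm (fun x => gradient (φ k) x - G x) 2 (volume.restrict Ω))
      atTop (𝓝 0)

/-- The Hardy constant: the infimum of `∫_Ω |∇u|² / ∫_Ω V u²` over all nonzero
`u ∈ D^{1,2}_0(Ω)`, an element of `[0, ∞]`. Both integrals are Lebesgue integrals of nonnegative
functions, so that no integrability of `V u²` is presupposed (the quotient of a finite number
by `∞` is `0`). -/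
def hardyConstant {N n : ℕ} (Ω : Opens (EuclideanSpace ℝ (Fin N)))
    (a : Fin n → EuclideanSpace ℝ (Fin N)) : ℝ≥0∞ :=
  sInf {q : ℝ≥0∞ | ∃ (u : EuclideanSpace ℝ (Fin N) → ℝ)
      (G : EuclideanSpace ℝ (Fin N) → EuclideanSpace ℝ (Fin N)),
    MemD12 Ω u G ∧ ¬ (u =ᵐ[volume.restrict Ω] 0) ∧
    q = (∫⁻ x in Ω, ENNReal.ofReal (‖G x‖ ^ 2)) /
        (∫⁻ x in Ω, ENNReal.ofReal (potential a x * u x ^ 2))}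

end MultipolarHardy

end

/-
Completing the square in `∫ |∇φ + φ F|² ≥ 0` gives `∫ (div F - |F|²) φ² ≤ ∫ |∇φ|²` for every smooth
vector field `F`. With `W_ε = ∑ (x - a_i) / (|x - a_i|² + ε)` and `β = (N - 2) / n`, the weight of
`F = β W_ε` is at least `β² (n ∑ (|x - a_i|² + ε)⁻¹ - |W_ε|²)`. At `ε = 0` the bracket is `V`,
because `V` is the sum of the squared mutual distances of the inverted points
`(x - a_i) / |x - a_i|²`, so Fatou's lemma yields the constant `β²` on `D^{1,2}_0`.

On a bounded set and for `n ≥ 3`, replace `β W_ε` by a convex combination of two fields. Near a pole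
`|W_ε|²` is at most a fixed fraction of the bracket, and there `3/2 β W_ε` does strictly better.
Away from the poles the gain comes from `β W_ε + t Φ x` with `Φ = ∏ (|x - a_i|² + ε)^β`: as
`∇Φ = 2 β Φ W_ε`, the derivative of `Φ` cancels the cross term of the square, and what is left is
`t Φ (N - t Φ |x|²)`, positive for small `t`. The weights combine well because `|F|²` is convex in
`F`.

For the upper bound, `V ~ (n - 1) |x - a_k|⁻²` at the pole `a_k`, and the cut-off functions
`(|x - a_k|² + ε) ^ (-(N - 2) / 4)` approach the optimal constant `(N - 2)² / 4` of the one-pole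
Hardy inequality as `ε → 0`.
-/

noncomputable section

namespace MultipolarHardy

theorem testFunction_apply_eq_zero {E : Type*} [NormedAddCommGroup E] [NormedSpace ℝ E]
    {Ω : Opens E} (φ : 𝓓(Ω, ℝ)) {x : E} (hx : x ∉ Ω) : φ x = 0 :=
  image_eq_zero_of_notMem_tsupport fun h => hx (φ.tsupport_subset h)

section HardyDensity

variable {E : Type*} [NormedAddCommGroup E] [InnerProductSpace ℝ E]

/-- The divergence of a vector field, as the trace of its derivative. -/
def divergence (F : E → E) (x : E) : ℝ := LinearMap.trace ℝ E (fderiv ℝ F x)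

/-- The weight `div F - |F|²` of the Hardy inequality `integral_sq_mul_hardyDensity_le` given by
the vector field `F`. If `F = -∇w / w`, this is `-Δw / w`. -/
def hardyDensity (F : E → E) (x : E) : ℝ := divergence F x - ‖F x‖ ^ 2

section Divergence

variable {F G : E → E} {f : E → ℝ} {x : E}

theorem divergence_add (hF : DifferentiableAt ℝ F x) (hG : DifferentiableAt ℝ G x) :
    divergence (fun y => F y + G y) x = divergence F x + divergence G x := by
  rw [divergence, fderiv_fun_add hF hG, ContinuousLinearMap.toLinearMap_add, map_add]
  rfl

theorem divergence_const_smul (c : ℝ) (hF : DifferentiableAt ℝ F x) :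
    divergence (fun y => c • F y) x = c * divergence F x := by
  rw [divergence, fderiv_fun_const_smul hF, ContinuousLinearMap.toLinearMap_smul, map_smul]
  rfl

theorem divergence_sum {ι : Type*} {s : Finset ι} {F : ι → E → E}
    (hF : ∀ i ∈ s, DifferentiableAt ℝ (F i) x) :
    divergence (fun y => ∑ i ∈ s, F i y) x = ∑ i ∈ s, divergence (F i) x := by
  rw [divergence, fderiv_fun_sum hF, ContinuousLinearMap.toLinearMap_sum, map_sum]
  rfl

theorem hardyDensity_convexCombination (hF : DifferentiableAt ℝ F x) (hG : DifferentiableAt ℝ G x)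
    {s t : ℝ} (hs : 0 ≤ s) (ht : 0 ≤ t) (hst : s + t = 1) :
    s * hardyDensity F x + t * hardyDensity G x ≤ hardyDensity (fun y => s • F y + t • G y) x := by
  have h := ((convexOn_norm (convex_univ (𝕜 := ℝ) (E := E))).pow (fun _ _ => norm_nonneg _) 2).2
    (Set.mem_univ (F x)) (Set.mem_univ (G x)) hs ht hst
  simp only [Pi.pow_apply, smul_eq_mul] at h
  rw [hardyDensity, hardyDensity, hardyDensity,
    divergence_add (hF.fun_const_smul s) (hG.fun_const_smul t),
    divergence_const_smul s hF, divergence_const_smul t hG]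
  linarith

variable [FiniteDimensional ℝ E]

theorem divergence_smul (hf : DifferentiableAt ℝ f x) (hF : DifferentiableAt ℝ F x) :
    divergence (fun y => f y • F y) x = f x * divergence F x + fderiv ℝ f x (F x) := by
  have h : (fderiv ℝ (fun y => f y • F y) x : E →ₗ[ℝ] E)
      = f x • (fderiv ℝ F x : E →ₗ[ℝ] E) + (fderiv ℝ f x : E →ₗ[ℝ] ℝ).smulRight (F x) := by
    rw [fderiv_fun_smul hf hF]
    rfl
  rw [divergence, h, map_add, map_smul, LinearMap.trace_smulRight]
  rfl

theorem divergence_sub_const (a : E) : divergence (fun y => y - a) x = Module.finrank ℝ E := by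
  rw [divergence, fderiv_sub_const]
  simp

theorem continuous_divergence (hF : ContDiff ℝ 1 F) : Continuous (divergence F) :=
  ((LinearMap.trace ℝ E ∘ₗ ContinuousLinearMap.coeLM ℝ).continuous_of_finiteDimensional).comp
    (hF.continuous_fderiv one_ne_zero)

end Divergence

variable [FiniteDimensional ℝ E] {φ : E → ℝ} {F : E → E}

theorem continuous_gradient (hφ : ContDiff ℝ 1 φ) : Continuous (gradient φ) :=
  (InnerProductSpace.toDual ℝ E).symm.continuous.comp (hφ.continuous_fderiv one_ne_zero)

theorem hasCompactSupport_gradient (hφ : HasCompactSupport φ) : HasCompactSupport (gradient φ) :=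
  (hφ.fderiv ℝ).comp_left (map_zero (InnerProductSpace.toDual ℝ E).symm)

theorem support_gradient_testFunction_subset {Ω : Opens E} (φ : 𝓓(Ω, ℝ)) :
    Function.support (gradient φ) ⊆ Ω := by
  intro x hx
  refine φ.tsupport_subset (support_fderiv_subset ℝ (f := φ) ?_)
  contrapose! hx
  simp [gradient, Function.notMem_support.mp hx]

theorem norm_gradient_add_smul_sq {x : E} (hφ : DifferentiableAt ℝ φ x)
    (hF : DifferentiableAt ℝ F x) :
    ‖gradient φ x + φ x • F x‖ ^ 2 = ‖gradient φ x‖ ^ 2 - φ x ^ 2 * hardyDensity F x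
      + divergence (fun y => φ y ^ 2 • F y) x := by
  have hdiv : divergence (fun y => φ y ^ 2 • F y) x
      = φ x ^ 2 * divergence F x + 2 * φ x * inner ℝ (gradient φ x) (F x) := by
    rw [divergence_smul (hφ.fun_pow 2) hF, fderiv_fun_pow 2 hφ]
    simp [gradient]
  rw [hdiv, hardyDensity, norm_add_sq_real, norm_smul, inner_smul_right, mul_pow,
    Real.norm_eq_abs, sq_abs]
  ring

variable [MeasurableSpace E] [BorelSpace E]

theorem integrable_fderiv_apply (hφ : ContDiff ℝ 1 φ) (hφs : HasCompactSupport φ) (v : E) :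
    Integrable fun x => fderiv ℝ φ x v :=
  ((hφ.continuous_fderiv one_ne_zero).clm_apply continuous_const).integrable_of_hasCompactSupport
    (hφs.fderiv_apply ℝ v)

theorem integral_fderiv_apply_eq_zero (hφ : ContDiff ℝ 1 φ) (hφs : HasCompactSupport φ) (v : E) :
    ∫ x, fderiv ℝ φ x v = 0 := by
  simpa using integral_mul_fderiv_eq_neg_fderiv_mul_of_integrable (μ := volume) (v := v)
    (f := fun _ : E => (1 : ℝ)) (g := φ) (by simp)
    (by simpa using integrable_fderiv_apply hφ hφs v)
    (by simpa using hφ.continuous.integrable_of_hasCompactSupport hφs)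
    (fun x _ => differentiableAt_const _) (fun x _ => hφ.differentiable one_ne_zero x)

theorem integral_divergence_eq_zero (hF : ContDiff ℝ 1 F) (hFs : HasCompactSupport F) :
    ∫ x, divergence F x = 0 := by
  let b := stdOrthonormalBasis ℝ E
  have hcoord : ∀ i, ContDiff ℝ 1 fun x => inner ℝ (b i) (F x) := fun i =>
    contDiff_const.inner ℝ hF
  have hcoords : ∀ i, HasCompactSupport fun x => inner ℝ (b i) (F x) := fun i =>
    hFs.comp_left (g := fun v => inner ℝ (b i) v) (inner_zero_right _)
  have hdiv : ∀ x, divergence F x = ∑ i, fderiv ℝ (fun y => inner ℝ (b i) (F y)) x (b i) :=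
    fun x => by
      rw [divergence, LinearMap.trace_eq_sum_inner _ b]
      simp [fderiv_inner_apply ℝ (differentiableAt_const _) (hF.differentiable one_ne_zero x)]
  simp_rw [hdiv]
  rw [integral_finsetSum _ fun i _ => integrable_fderiv_apply (hcoord i) (hcoords i) (b i)]
  exact Finset.sum_eq_zero fun i _ => integral_fderiv_apply_eq_zero (hcoord i) (hcoords i) (b i)

theorem integrable_norm_gradient_sq (hφ : ContDiff ℝ 1 φ) (hφs : HasCompactSupport φ) :
    Integrable fun x => ‖gradient φ x‖ ^ 2 := by
  have := continuous_gradient hφ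
  exact Continuous.integrable_of_hasCompactSupport (by fun_prop)
    ((hasCompactSupport_gradient hφs).comp_left (g := fun v => ‖v‖ ^ 2) (by simp))

theorem integrable_sq_mul_hardyDensity (hφ : Continuous φ) (hφs : HasCompactSupport φ)
    (hF : ContDiff ℝ 1 F) : Integrable fun x => φ x ^ 2 * hardyDensity F x := by
  have hsqs : HasCompactSupport fun x => φ x ^ 2 :=
    hφs.comp_left (g := fun t : ℝ => t ^ 2) (by simp)
  have hdivF := continuous_divergence hF
  have hFc := hF.continuous
  unfold hardyDensity
  exact Continuous.integrable_of_hasCompactSupport (by fun_prop) hsqs.mul_right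

theorem integral_sq_mul_hardyDensity_le (hφ : ContDiff ℝ 1 φ) (hφs : HasCompactSupport φ)
    (hF : ContDiff ℝ 1 F) :
    ∫ x, φ x ^ 2 * hardyDensity F x ≤ ∫ x, ‖gradient φ x‖ ^ 2 := by
  have hG : ContDiff ℝ 1 fun x => φ x ^ 2 • F x := (hφ.pow 2).smul hF
  have hGs : HasCompactSupport fun x => φ x ^ 2 • F x :=
    (hφs.comp_left (g := fun t : ℝ => t ^ 2) (by simp)).smul_right
  have hgap : ∫ x, (φ x ^ 2 * hardyDensity F x - ‖gradient φ x‖ ^ 2)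
      ≤ ∫ x, divergence (fun y => φ y ^ 2 • F y) x := by
    refine integral_mono ?_ ?_ fun x => ?_
    · exact (integrable_sq_mul_hardyDensity hφ.continuous hφs hF).sub
        (integrable_norm_gradient_sq hφ hφs)
    · exact (continuous_divergence hG).integrable_of_hasCompactSupport
        ((hGs.fderiv ℝ).comp_left (g := fun T : E →L[ℝ] E => LinearMap.trace ℝ E T) (by simp))
    · have hsquare := norm_gradient_add_smul_sq (hφ.differentiable one_ne_zero x)
        (hF.differentiable one_ne_zero x)
      linarith [sq_nonneg ‖gradient φ x + φ x • F x‖]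
  rw [integral_divergence_eq_zero hG hGs, integral_sub
    (integrable_sq_mul_hardyDensity hφ.continuous hφs hF) (integrable_norm_gradient_sq hφ hφs)]
    at hgap
  linarith

variable {Ω : Opens E}

theorem setLIntegral_hardyDensity_mul_sq_le (φ : 𝓓(Ω, ℝ)) (hF : ContDiff ℝ 1 F)
    (hF0 : ∀ x ∈ Ω, 0 ≤ hardyDensity F x) :
    ∫⁻ x in Ω, ENNReal.ofReal (hardyDensity F x * φ x ^ 2)
      ≤ ∫⁻ x in Ω, ENNReal.ofReal (‖gradient φ x‖ ^ 2) := by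
  have hφ : ContDiff ℝ 1 φ := φ.contDiff.of_le (by simp)
  have hnonneg : ∀ x, 0 ≤ φ x ^ 2 * hardyDensity F x := fun x => by
    by_cases hx : x ∈ Ω
    · exact mul_nonneg (sq_nonneg _) (hF0 x hx)
    · simp [testFunction_apply_eq_zero φ hx]
  calc ∫⁻ x in Ω, ENNReal.ofReal (hardyDensity F x * φ x ^ 2)
      ≤ ∫⁻ x, ENNReal.ofReal (φ x ^ 2 * hardyDensity F x) := by
        simp_rw [mul_comm (hardyDensity F _)]
        exact setLIntegral_le_lintegral _ _
    _ = ENNReal.ofReal (∫ x, φ x ^ 2 * hardyDensity F x) :=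
        (ofReal_integral_eq_lintegral_ofReal
          (integrable_sq_mul_hardyDensity φ.continuous φ.hasCompactSupport hF)
          (Eventually.of_forall hnonneg)).symm
    _ ≤ ENNReal.ofReal (∫ x, ‖gradient φ x‖ ^ 2) :=
        ENNReal.ofReal_le_ofReal (integral_sq_mul_hardyDensity_le hφ φ.hasCompactSupport hF)
    _ = ∫⁻ x, ENNReal.ofReal (‖gradient φ x‖ ^ 2) :=
        ofReal_integral_eq_lintegral_ofReal (integrable_norm_gradient_sq hφ φ.hasCompactSupport)
          (Eventually.of_forall fun x => sq_nonneg _)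
    _ = ∫⁻ x in Ω, ENNReal.ofReal (‖gradient φ x‖ ^ 2) := by
        refine (setLIntegral_eq_of_support_subset fun x hx => ?_).symm
        refine support_gradient_testFunction_subset φ ?_
        contrapose! hx
        simp [Function.notMem_support.mp hx]

end HardyDensity

section Poles

variable {E ι : Type*} [NormedAddCommGroup E] [Fintype ι]

/-- The sum `∑ |x - a_i|⁻²`, with every `|x - a_i|²` regularized to `|x - a_i|² + ε`. -/
def poleSum (a : ι → E) (ε : ℝ) (x : E) : ℝ := ∑ i, (‖x - a i‖ ^ 2 + ε)⁻¹

/-- The product `∏ |x - a_i| ^ (2 α)`, with every `|x - a_i|²` regularized to `|x - a_i|² + ε`. -/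
def poleWeight (a : ι → E) (α ε : ℝ) (x : E) : ℝ := ∏ i, (‖x - a i‖ ^ 2 + ε) ^ α

/-- The vector field `∑ |x - a_i|⁻² (x - a_i)`, with every `|x - a_i|²` regularized to
`|x - a_i|² + ε`. -/
def poleField [NormedSpace ℝ E] (a : ι → E) (ε : ℝ) (x : E) : E :=
  ∑ i, (‖x - a i‖ ^ 2 + ε)⁻¹ • (x - a i)

/-- A regularization of the multipolar potential, which it equals at `ε = 0` away from the poles
(`regularizedPotential_zero`). -/
def regularizedPotential [NormedSpace ℝ E] (a : ι → E) (ε : ℝ) (x : E) : ℝ :=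
  Fintype.card ι * poleSum a ε x - ‖poleField a ε x‖ ^ 2

theorem poleWeight_pos (a : ι → E) (α : ℝ) {ε : ℝ} (hε : 0 < ε) (x : E) :
    0 < poleWeight a α ε x :=
  Finset.prod_pos fun i _ => by positivity

theorem inv_le_poleSum (a : ι → E) {ε : ℝ} (hε : 0 ≤ ε) (k : ι) (x : E) :
    (‖x - a k‖ ^ 2 + ε)⁻¹ ≤ poleSum a ε x :=
  Finset.single_le_sum (f := fun i => (‖x - a i‖ ^ 2 + ε)⁻¹) (fun i _ => by positivity)
    (Finset.mem_univ k)

theorem continuousAt_poleSum {a : ι → E} {z : E × ℝ} (hz : ∀ i, ‖z.1 - a i‖ ^ 2 + z.2 ≠ 0) :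
    ContinuousAt (fun z : E × ℝ => poleSum a z.2 z.1) z :=
  tendsto_finsetSum _ fun i _ => ContinuousAt.inv₀ (by fun_prop) (hz i)

theorem continuousAt_poleField [NormedSpace ℝ E] {a : ι → E} {z : E × ℝ}
    (hz : ∀ i, ‖z.1 - a i‖ ^ 2 + z.2 ≠ 0) :
    ContinuousAt (fun z : E × ℝ => poleField a z.2 z.1) z :=
  tendsto_finsetSum _ fun i _ =>
    ContinuousAt.smul (ContinuousAt.inv₀ (by fun_prop) (hz i)) (by fun_prop)

theorem continuousAt_regularizedPotential [NormedSpace ℝ E] {a : ι → E} {z : E × ℝ}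
    (hz : ∀ i, ‖z.1 - a i‖ ^ 2 + z.2 ≠ 0) :
    ContinuousAt (fun z : E × ℝ => regularizedPotential a z.2 z.1) z :=
  ((continuousAt_poleSum hz).const_mul _).sub ((continuousAt_poleField hz).norm.pow 2)

theorem continuous_regularizedPotential [NormedSpace ℝ E] (a : ι → E) {ε : ℝ} (hε : 0 < ε) :
    Continuous (regularizedPotential a ε) :=
  continuous_iff_continuousAt.mpr fun x =>
    (continuousAt_regularizedPotential (z := (x, ε)) fun _ => by positivity).comp
      (f := fun x => (x, ε)) (by fun_prop)

theorem continuousAt_poleWeight {a : ι → E} (α : ℝ) {z : E × ℝ}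
    (hz : ∀ i, ‖z.1 - a i‖ ^ 2 + z.2 ≠ 0) :
    ContinuousAt (fun z : E × ℝ => poleWeight a α z.2 z.1) z :=
  tendsto_finsetProd _ fun i _ => ContinuousAt.rpow_const (by fun_prop) (Or.inl (hz i))

theorem continuous_poleWeight (a : ι → E) {α : ℝ} (hα : 0 ≤ α) :
    Continuous fun z : E × ℝ => poleWeight a α z.2 z.1 :=
  continuous_finsetProd _ fun i _ => Continuous.rpow_const (by fun_prop) fun _ => Or.inr hα

theorem norm_inv_smul_sub_sq_le [NormedSpace ℝ E] (a : E) {ε : ℝ} (hε : 0 ≤ ε) (x : E) :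
    ‖(‖x - a‖ ^ 2 + ε)⁻¹ • (x - a)‖ ^ 2 ≤ (‖x - a‖ ^ 2 + ε)⁻¹ := by
  have hq : 0 ≤ ‖x - a‖ ^ 2 + ε := by positivity
  calc ‖(‖x - a‖ ^ 2 + ε)⁻¹ • (x - a)‖ ^ 2
      = (‖x - a‖ ^ 2 + ε)⁻¹ * (‖x - a‖ ^ 2 / (‖x - a‖ ^ 2 + ε)) := by
        rw [norm_smul, mul_pow, Real.norm_of_nonneg (inv_nonneg.mpr hq)]
        ring
    _ ≤ (‖x - a‖ ^ 2 + ε)⁻¹ * 1 := by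
        gcongr
        exact div_le_one_of_le₀ (by linarith) hq
    _ = _ := mul_one _

theorem regularizedPotential_nonneg [NormedSpace ℝ E] (a : ι → E) {ε : ℝ} (hε : 0 ≤ ε) (x : E) :
    0 ≤ regularizedPotential a ε x := by
  refine sub_nonneg.mpr ?_
  calc ‖poleField a ε x‖ ^ 2
      ≤ (∑ i, ‖(‖x - a i‖ ^ 2 + ε)⁻¹ • (x - a i)‖) ^ 2 := by
        gcongr
        exact norm_sum_le _ _
    _ ≤ Fintype.card ι * ∑ i, ‖(‖x - a i‖ ^ 2 + ε)⁻¹ • (x - a i)‖ ^ 2 :=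
        sq_sum_le_card_mul_sum_sq
    _ ≤ Fintype.card ι * poleSum a ε x := by
        unfold poleSum
        gcongr with i
        exact norm_inv_smul_sub_sq_le (a i) hε x

theorem exists_pos_mul_poleWeight_mul_norm_sq_le (a : ι → E) {K : Set E} (hK : IsCompact K)
    {α : ℝ} (hα : 0 ≤ α) : ∃ t > 0, ∀ x ∈ K, ∀ ε ∈ Set.Ioc (0 : ℝ) 1,
      t * poleWeight a α ε x * ‖x‖ ^ 2 ≤ 1 := by
  have hweight := continuous_poleWeight a hα
  obtain ⟨C, hC⟩ := (hK.prod (isCompact_Icc (a := (0 : ℝ)) (b := 1))).exists_bound_of_continuousOn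
    (f := fun z : E × ℝ => poleWeight a α z.2 z.1 * ‖z.1‖ ^ 2) (by fun_prop)
  refine ⟨(max C 1)⁻¹, by positivity, fun x hx ε hε => ?_⟩
  rw [mul_assoc, inv_mul_le_one₀ (by positivity)]
  exact ((Real.le_norm_self _).trans (hC (x, ε) ⟨hx, hε.1.le, hε.2⟩)).trans (le_max_left _ _)

section NearPoles

variable [NormedSpace ℝ E] {a : ι → E}

/- In terms of `q = |x - a_k|² + ε`, the `k`-th term of the field has norm at most `q^{-1/2}`, while
the other terms stay bounded near the pole. -/
theorem eventually_norm_poleField_sq_le (ha : Function.Injective a) (k : ι) {δ : ℝ} (hδ : 0 < δ) :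
    ∀ᶠ z : E × ℝ in 𝓝 (a k, 0), 0 ≤ z.2 → 0 < ‖z.1 - a k‖ ^ 2 + z.2 →
      ‖poleField a z.2 z.1‖ ^ 2 ≤ (1 + δ) * (‖z.1 - a k‖ ^ 2 + z.2)⁻¹ := by
  classical
  let rest : E × ℝ → E := fun z =>
    ∑ i ∈ Finset.univ.erase k, (‖z.1 - a i‖ ^ 2 + z.2)⁻¹ • (z.1 - a i)
  have hrest : ContinuousAt rest (a k, 0) := by
    refine tendsto_finsetSum _ fun i hi => ContinuousAt.smul (ContinuousAt.inv₀ ?_ ?_) ?_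
    · fun_prop
    · simpa [sub_eq_zero] using ha.ne (Finset.ne_of_mem_erase hi).symm
    · fun_prop
  have hlim : Tendsto (fun z : E × ℝ => (1 + √(‖z.1 - a k‖ ^ 2 + z.2) * ‖rest z‖) ^ 2)
      (𝓝 (a k, 0)) (𝓝 1) := by
    have h : ContinuousAt (fun z : E × ℝ => (1 + √(‖z.1 - a k‖ ^ 2 + z.2) * ‖rest z‖) ^ 2)
        (a k, 0) := by fun_prop
    simpa [ContinuousAt] using h
  filter_upwards [hlim.eventually_lt_const (lt_add_of_pos_right 1 hδ)] with ⟨x, ε⟩ hlt hε hq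
  set q := ‖x - a k‖ ^ 2 + ε
  have := Real.sqrt_pos.mpr hq
  have hpole : ‖q⁻¹ • (x - a k)‖ ≤ (√q)⁻¹ := by
    rw [← Real.sqrt_inv]
    exact Real.le_sqrt_of_sq_le (norm_inv_smul_sub_sq_le (a k) hε x)
  have hsplit : poleField a ε x = q⁻¹ • (x - a k) + rest (x, ε) :=
    (Finset.add_sum_erase _ _ (Finset.mem_univ k)).symm
  calc ‖poleField a ε x‖ ^ 2 ≤ ((√q)⁻¹ + ‖rest (x, ε)‖) ^ 2 := by
        rw [hsplit]
        gcongr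
        exact (norm_add_le _ _).trans (by gcongr)
    _ = (1 + √q * ‖rest (x, ε)‖) ^ 2 * q⁻¹ := by
        nth_rw 3 [← Real.sq_sqrt hq.le]
        field_simp
    _ ≤ (1 + δ) * q⁻¹ := by gcongr

theorem eventually_norm_poleField_sq_le_regularizedPotential (ha : Function.Injective a)
    (hι : 3 ≤ Fintype.card ι) (k : ι) :
    ∀ᶠ z : E × ℝ in 𝓝 (a k, 0), 0 ≤ z.2 → 0 < ‖z.1 - a k‖ ^ 2 + z.2 →
      5 * ‖poleField a z.2 z.1‖ ^ 2 ≤ 3 * regularizedPotential a z.2 z.1 := by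
  filter_upwards [eventually_norm_poleField_sq_le ha k (by norm_num : (0 : ℝ) < 1 / 8)] with
    ⟨x, ε⟩ hfield hε hq
  have hnear : ‖poleField a ε x‖ ^ 2 ≤ (1 + 1 / 8) * (‖x - a k‖ ^ 2 + ε)⁻¹ := hfield hε hq
  have hsum := inv_le_poleSum a hε k x
  have hcard : 3 * poleSum a ε x ≤ Fintype.card ι * poleSum a ε x := by
    gcongr
    · exact (inv_nonneg.mpr hq.le).trans hsum
    · exact_mod_cast hι
  rw [regularizedPotential]
  linarith

theorem exists_norm_poleField_sq_le_mul_poleWeight (ha : Function.Injective a)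
    (hι : 3 ≤ Fintype.card ι) {K : Set E} (hK : IsCompact K) (α : ℝ) :
    ∃ M, 0 ≤ M ∧ ∀ x ∈ K, ∀ ε ∈ Set.Ioc (0 : ℝ) 1,
      5 * ‖poleField a ε x‖ ^ 2 ≤ 3 * regularizedPotential a ε x + M * poleWeight a α ε x := by
  let U : ι → Set (E × ℝ) := fun k => interior {z | 0 ≤ z.2 → 0 < ‖z.1 - a k‖ ^ 2 + z.2 →
    5 * ‖poleField a z.2 z.1‖ ^ 2 ≤ 3 * regularizedPotential a z.2 z.1}
  have hU : ∀ k, (a k, 0) ∈ U k := fun k =>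
    mem_interior_iff_mem_nhds.mpr (eventually_norm_poleField_sq_le_regularizedPotential ha hι k)
  let T : Set (E × ℝ) := (K ×ˢ Set.Icc 0 1) \ ⋃ k, U k
  have hT : IsCompact T := (hK.prod isCompact_Icc).diff (isOpen_iUnion fun k => isOpen_interior)
  have hTpos : ∀ z ∈ T, ∀ i, 0 < ‖z.1 - a i‖ ^ 2 + z.2 := by
    rintro ⟨x, ε⟩ ⟨⟨-, hε, -⟩, hzU⟩ i
    refine (add_nonneg (sq_nonneg _) hε).lt_of_ne' fun hzero => hzU (Set.mem_iUnion.mpr ⟨i, ?_⟩)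
    obtain ⟨hx, rfl⟩ := (add_eq_zero_iff_of_nonneg (sq_nonneg _) hε).mp hzero
    obtain rfl : x = a i := by simpa [sub_eq_zero] using hx
    exact hU i
  have hcont : ContinuousOn
      (fun z : E × ℝ => 5 * ‖poleField a z.2 z.1‖ ^ 2 / poleWeight a α z.2 z.1) T :=
    fun z hz => by
      have hne : ∀ i, ‖z.1 - a i‖ ^ 2 + z.2 ≠ 0 := fun i => (hTpos z hz i).ne'
      have hweight : poleWeight a α z.2 z.1 ≠ 0 :=
        (Finset.prod_pos fun i _ => Real.rpow_pos_of_pos (hTpos z hz i) α).ne'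
      exact ((((continuousAt_poleField hne).norm.pow 2).const_mul 5).div
        (continuousAt_poleWeight α hne) hweight).continuousWithinAt
  obtain ⟨C, hC⟩ := hT.exists_bound_of_continuousOn hcont
  refine ⟨max C 0, le_max_right _ _, fun x hx ε hε => ?_⟩
  have hweight := poleWeight_pos a α hε.1 x
  by_cases hxU : (x, ε) ∈ ⋃ k, U k
  · obtain ⟨k, hk⟩ := Set.mem_iUnion.mp hxU
    have hε0 := hε.1
    exact (interior_subset hk hε0.le (by positivity)).trans (le_add_of_nonneg_right (by positivity))
  · have hfar := (Real.le_norm_self _).trans (hC (x, ε) ⟨⟨hx, hε.1.le, hε.2⟩, hxU⟩)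
    rw [div_le_iff₀ hweight] at hfar
    have hM : C * poleWeight a α ε x ≤ max C 0 * poleWeight a α ε x := by
      gcongr
      exact le_max_left _ _
    linarith [regularizedPotential_nonneg a hε.1.le x]

end NearPoles

section Density

variable [InnerProductSpace ℝ E]

theorem hasFDerivAt_norm_sub_sq_add (a : E) (ε : ℝ) (x : E) :
    HasFDerivAt (fun y => ‖y - a‖ ^ 2 + ε) (2 • innerSL ℝ (x - a)) x := by
  simpa [Function.comp_def] using ((hasStrictFDerivAt_norm_sq (x - a)).hasFDerivAt.comp x
    ((hasFDerivAt_id x).sub_const a)).add_const ε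

theorem contDiff_norm_sub_sq_add (a : E) (ε : ℝ) {m : WithTop ℕ∞} :
    ContDiff ℝ m (fun y : E => ‖y - a‖ ^ 2 + ε) :=
  ((contDiff_id.sub contDiff_const).norm_sq ℝ).add contDiff_const

theorem contDiff_inv_norm_sub_sq_add (a : E) {ε : ℝ} (hε : 0 < ε) {m : WithTop ℕ∞} :
    ContDiff ℝ m (fun y : E => (‖y - a‖ ^ 2 + ε)⁻¹) :=
  (contDiff_norm_sub_sq_add a ε).inv fun y => by positivity

theorem contDiff_poleField (a : ι → E) {ε : ℝ} (hε : 0 < ε) {m : WithTop ℕ∞} :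
    ContDiff ℝ m (poleField a ε) :=
  ContDiff.sum fun i _ =>
    (contDiff_inv_norm_sub_sq_add (a i) hε).smul (contDiff_id.sub contDiff_const)

theorem contDiff_poleWeight (a : ι → E) (α : ℝ) {ε : ℝ} (hε : 0 < ε) {m : WithTop ℕ∞} :
    ContDiff ℝ m (poleWeight a α ε) :=
  contDiff_prod fun i _ => (contDiff_norm_sub_sq_add (a i) ε).rpow_const_of_ne
    fun y => by positivity

theorem fderiv_poleWeight_apply (a : ι → E) (α : ℝ) {ε : ℝ} (hε : 0 < ε) (x v : E) :
    fderiv ℝ (poleWeight a α ε) x v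
      = 2 * α * poleWeight a α ε x * inner ℝ (poleField a ε x) v := by
  have hexp : ∀ y, poleWeight a α ε y
      = Real.exp (∑ i, Real.log (‖y - a i‖ ^ 2 + ε) * α) := fun y => by
    rw [Real.exp_sum]
    exact Finset.prod_congr rfl fun i _ => Real.rpow_def_of_pos (by positivity) _
  have hderiv : HasFDerivAt (fun y => Real.exp (∑ i, Real.log (‖y - a i‖ ^ 2 + ε) * α))
      (Real.exp (∑ i, Real.log (‖x - a i‖ ^ 2 + ε) * α) •
        ∑ i, α • (‖x - a i‖ ^ 2 + ε)⁻¹ • (2 • innerSL ℝ (x - a i))) x :=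
    (HasFDerivAt.fun_sum fun i _ =>
      ((hasFDerivAt_norm_sub_sq_add (a i) ε x).log (by positivity)).mul_const α).exp
  rw [funext hexp, hderiv.fderiv, ← hexp, ← funext hexp]
  simp only [poleField, smul_apply, sum_apply,
    innerSL_apply_apply, smul_eq_mul, nsmul_eq_mul, sum_inner, inner_smul_left, Finset.mul_sum]
  refine Finset.sum_congr rfl fun i _ => ?_
  simp only [Nat.cast_ofNat, conj_trivial]
  ring

variable [FiniteDimensional ℝ E]

theorem le_divergence_inv_smul_sub (a : E) {ε : ℝ} (hε : 0 < ε) (x : E) :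
    ((Module.finrank ℝ E : ℝ) - 2) * (‖x - a‖ ^ 2 + ε)⁻¹
      ≤ divergence (fun y => (‖y - a‖ ^ 2 + ε)⁻¹ • (y - a)) x := by
  have hq : 0 < ‖x - a‖ ^ 2 + ε := by positivity
  have hderiv : fderiv ℝ (fun y => (‖y - a‖ ^ 2 + ε)⁻¹) x (x - a)
      = -(2 * (‖x - a‖ ^ 2 * ((‖x - a‖ ^ 2 + ε) ^ 2)⁻¹)) := by
    have h : HasFDerivAt (fun y => (‖y - a‖ ^ 2 + ε)⁻¹) _ x :=
      (hasDerivAt_inv hq.ne').comp_hasFDerivAt x (hasFDerivAt_norm_sub_sq_add a ε x)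
    rw [h.fderiv]
    simp only [smul_apply, innerSL_apply_apply, real_inner_self_eq_norm_sq, smul_eq_mul,
      nsmul_eq_mul, Nat.cast_ofNat]
    ring
  have hle : ‖x - a‖ ^ 2 * ((‖x - a‖ ^ 2 + ε) ^ 2)⁻¹ ≤ (‖x - a‖ ^ 2 + ε)⁻¹ := by
    rw [← div_eq_mul_inv, ← one_div, div_le_div_iff₀ (by positivity) hq]
    nlinarith
  rw [divergence_smul ((contDiff_inv_norm_sub_sq_add a hε (m := 1)).differentiable one_ne_zero x)
    (by fun_prop), divergence_sub_const, hderiv]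
  linarith

theorem le_divergence_poleField (a : ι → E) {ε : ℝ} (hε : 0 < ε) (x : E) :
    ((Module.finrank ℝ E : ℝ) - 2) * poleSum a ε x ≤ divergence (poleField a ε) x := by
  have hdiff : ∀ i, DifferentiableAt ℝ (fun y => (‖y - a i‖ ^ 2 + ε)⁻¹ • (y - a i)) x := fun i =>
    ((contDiff_inv_norm_sub_sq_add (a i) hε (m := 1)).differentiable one_ne_zero x).smul
      (by fun_prop)
  unfold poleField
  rw [divergence_sum fun i _ => hdiff i, poleSum, Finset.mul_sum]
  exact Finset.sum_le_sum fun i _ => le_divergence_inv_smul_sub (a i) hε x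

theorem le_hardyDensity_smul_poleField (a : ι → E) {c ε : ℝ} (hc : 0 ≤ c) (hε : 0 < ε) (x : E) :
    c * ((Module.finrank ℝ E : ℝ) - 2) * poleSum a ε x - c ^ 2 * ‖poleField a ε x‖ ^ 2
      ≤ hardyDensity (fun y => c • poleField a ε y) x := by
  rw [hardyDensity,
    divergence_const_smul c ((contDiff_poleField a hε (m := 1)).differentiable one_ne_zero x),
    norm_smul, mul_pow, Real.norm_of_nonneg hc, mul_assoc]
  gcongr
  exact le_divergence_poleField a hε x

/- The derivative of the weight along `x` cancels the cross term of the square. -/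
theorem hardyDensity_smul_poleField_add_poleWeight_smul (a : ι → E) (α t : ℝ) {ε : ℝ}
    (hε : 0 < ε) (x : E) :
    hardyDensity (fun y => α • poleField a ε y + t • (poleWeight a α ε y • y)) x
      = hardyDensity (fun y => α • poleField a ε y) x
        + t * poleWeight a α ε x * (Module.finrank ℝ E - t * poleWeight a α ε x * ‖x‖ ^ 2) := by
  have hfield : DifferentiableAt ℝ (poleField a ε) x :=
    (contDiff_poleField a hε (m := 1)).differentiable one_ne_zero x
  have hweight : DifferentiableAt ℝ (poleWeight a α ε) x :=
    (contDiff_poleWeight a α hε (m := 1)).differentiable one_ne_zero x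
  have hid : divergence (fun y : E => y) x = Module.finrank ℝ E := by
    simpa using divergence_sub_const (x := x) (0 : E)
  rw [hardyDensity, hardyDensity, divergence_add (by fun_prop) (by fun_prop),
    divergence_const_smul t (by fun_prop), divergence_smul hweight differentiableAt_fun_id, hid,
    fderiv_poleWeight_apply a α hε, norm_add_sq_real, inner_smul_left, inner_smul_right,
    inner_smul_right, norm_smul t, norm_smul (poleWeight a α ε x), mul_pow, mul_pow,
    Real.norm_eq_abs, Real.norm_eq_abs, sq_abs, sq_abs]
  simp only [conj_trivial]
  ring

theorem sq_mul_regularizedPotential_add_le_hardyDensity (a : ι → E) {β s : ℝ} (hβ : 0 ≤ β)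
    (hs : 0 ≤ s) (hdim : (Module.finrank ℝ E : ℝ) - 2 = Fintype.card ι * β) {ε : ℝ} (hε : 0 < ε)
    (x : E) :
    β ^ 2 * (s * regularizedPotential a ε x + s * (1 - s) * ‖poleField a ε x‖ ^ 2)
      ≤ hardyDensity (fun y => (s * β) • poleField a ε y) x := by
  have h := le_hardyDensity_smul_poleField a (mul_nonneg hs hβ) hε x
  rw [hdim] at h
  rw [regularizedPotential]
  linarith

theorem sq_mul_regularizedPotential_le_hardyDensity (a : ι → E) {β : ℝ} (hβ : 0 ≤ β)
    (hdim : (Module.finrank ℝ E : ℝ) - 2 = Fintype.card ι * β) {ε : ℝ} (hε : 0 < ε) (x : E) :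
    β ^ 2 * regularizedPotential a ε x ≤ hardyDensity (fun y => β • poleField a ε y) x := by
  simpa using sq_mul_regularizedPotential_add_le_hardyDensity a hβ zero_le_one hdim hε x

theorem le_hardyDensity_smul_poleField_add_poleWeight_smul (a : ι → E) {β t : ℝ} (hβ : 0 ≤ β)
    (ht : 0 ≤ t) (hdim : (Module.finrank ℝ E : ℝ) - 2 = Fintype.card ι * β) {ε : ℝ} (hε : 0 < ε)
    {x : E} (hweight : t * poleWeight a β ε x * ‖x‖ ^ 2 ≤ 1) :
    β ^ 2 * regularizedPotential a ε x + t * poleWeight a β ε x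
      ≤ hardyDensity (fun y => β • poleField a ε y + t • (poleWeight a β ε y • y)) x := by
  have hN : 2 ≤ (Module.finrank ℝ E : ℝ) := sub_nonneg.mp (hdim ▸ by positivity)
  have hΦ : 0 ≤ t * poleWeight a β ε x := mul_nonneg ht (poleWeight_pos a β hε x).le
  rw [hardyDensity_smul_poleField_add_poleWeight_smul a β t hε]
  exact add_le_add (sq_mul_regularizedPotential_le_hardyDensity a hβ hdim hε x)
    (le_mul_of_one_le_right hΦ (by linarith))

theorem exists_lt_forall_exists_le_hardyDensity {a : ι → E} (ha : Function.Injective a)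
    (hι : 3 ≤ Fintype.card ι) {K : Set E} (hK : IsCompact K) {β : ℝ} (hβ : 0 < β)
    (hdim : (Module.finrank ℝ E : ℝ) - 2 = Fintype.card ι * β) :
    ∃ c, β ^ 2 < c ∧ ∀ ε ∈ Set.Ioc (0 : ℝ) 1, ∃ F : E → E, ContDiff ℝ 1 F ∧
      ∀ x ∈ K, c * regularizedPotential a ε x ≤ hardyDensity F x := by
  obtain ⟨M, hM, hfield⟩ := exists_norm_poleField_sq_le_mul_poleWeight ha hι hK β
  obtain ⟨t, ht, hweight⟩ := exists_pos_mul_poleWeight_mul_norm_sq_le a hK hβ.le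
  let θ : ℝ := t / (t + β ^ 2 * M)
  have hθ : 0 < θ := by positivity
  have hθ' : 0 ≤ 1 - θ := sub_nonneg.mpr (div_le_one_of_le₀ (by nlinarith) (by positivity))
  have hbalance : (1 - θ) * t = θ * β ^ 2 * M := by
    have : t + β ^ 2 * M ≠ 0 := by positivity
    simp only [θ]
    field_simp
    ring
  refine ⟨β ^ 2 * (1 + θ / 20), by nlinarith [mul_pos (pow_pos hβ 2) hθ], fun ε hε => ?_⟩
  have hW := contDiff_poleField a hε.1 (m := 1)
  have hΦ := contDiff_poleWeight a β hε.1 (m := 1)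
  let F₁ : E → E := fun y => (3 / 2 * β) • poleField a ε y
  let F₂ : E → E := fun y => β • poleField a ε y + t • (poleWeight a β ε y • y)
  have hF₁ : ContDiff ℝ 1 F₁ := by fun_prop
  have hF₂ : ContDiff ℝ 1 F₂ := by fun_prop
  refine ⟨fun y => θ • F₁ y + (1 - θ) • F₂ y, by fun_prop, fun x hx => ?_⟩
  have hdensity₁ := sq_mul_regularizedPotential_add_le_hardyDensity a hβ.le
    (by norm_num : (0 : ℝ) ≤ 3 / 2) hdim hε.1 x
  have hdensity₂ : β ^ 2 * regularizedPotential a ε x + t * poleWeight a β ε x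
      ≤ hardyDensity F₂ x :=
    le_hardyDensity_smul_poleField_add_poleWeight_smul a hβ.le ht.le hdim hε.1 (hweight x hx ε hε)
  refine le_trans ?_ (hardyDensity_convexCombination (hF₁.differentiable one_ne_zero x)
    (hF₂.differentiable one_ne_zero x) hθ.le hθ' (by ring))
  calc β ^ 2 * (1 + θ / 20) * regularizedPotential a ε x
      ≤ θ * (β ^ 2 * (3 / 2 * regularizedPotential a ε x
          + 3 / 2 * (1 - 3 / 2) * ‖poleField a ε x‖ ^ 2))
        + (1 - θ) * (β ^ 2 * regularizedPotential a ε x + t * poleWeight a β ε x) := by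
        have hgain := mul_le_mul_of_nonneg_left (hfield x hx ε hε) (by positivity : 0 ≤ θ * β ^ 2)
        have hloss : (1 - θ) * t * poleWeight a β ε x = θ * β ^ 2 * M * poleWeight a β ε x := by
          rw [hbalance]
        have hΦ0 := poleWeight_pos a β hε.1 x
        have : 0 ≤ θ * β ^ 2 * M * poleWeight a β ε x := by positivity
        linarith
    _ ≤ θ * hardyDensity F₁ x + (1 - θ) * hardyDensity F₂ x := by gcongr

end Density

end Poles

section Potential

theorem sum_Ioi_norm_sub_sq {E : Type*} [NormedAddCommGroup E] [InnerProductSpace ℝ E] {n : ℕ}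
    (w : Fin n → E) :
    ∑ i, ∑ j ∈ Finset.Ioi i, ‖w i - w j‖ ^ 2 = n * ∑ i, ‖w i‖ ^ 2 - ‖∑ i, w i‖ ^ 2 := by
  have hpairs : 2 * ∑ i, ∑ j ∈ Finset.Ioi i, ‖w i - w j‖ ^ 2 = ∑ i, ∑ j, ‖w j - w i‖ ^ 2 := by
    calc 2 * ∑ i, ∑ j ∈ Finset.Ioi i, ‖w i - w j‖ ^ 2
        = ∑ i, ∑ j ∈ Finset.Ioi i, (‖w j - w i‖ ^ 2 + ‖w i - w j‖ ^ 2) := by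
          simp_rw [norm_sub_rev (w _) (w _), ← two_mul, Finset.mul_sum]
      _ = ∑ i, ∑ j ∈ {i}ᶜ, ‖w j - w i‖ ^ 2 :=
          Finset.sum_sum_Ioi_add_eq_sum_sum_off_diag fun i j => ‖w i - w j‖ ^ 2
      _ = ∑ i, ∑ j, ‖w j - w i‖ ^ 2 :=
          Finset.sum_congr rfl fun i _ => Finset.sum_subset (Finset.subset_univ _) fun j _ hj => by
            obtain rfl : j = i := by simpa using hj
            simp
  have hexpand : ∑ i, ∑ j, ‖w j - w i‖ ^ 2 = 2 * (n * ∑ i, ‖w i‖ ^ 2 - ‖∑ i, w i‖ ^ 2) := by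
    simp_rw [norm_sub_sq_real]
    rw [← real_inner_self_eq_norm_sq (∑ i, w i)]
    simp only [Finset.sum_add_distrib, Finset.sum_sub_distrib, sum_inner, inner_sum,
      Finset.sum_const, Finset.card_univ, Fintype.card_fin, nsmul_eq_mul, ← Finset.mul_sum]
    rw [Finset.sum_comm (f := fun i j => inner ℝ (w j) (w i))]
    ring
  linarith

variable {N n : ℕ} {Ω : Opens (EuclideanSpace ℝ (Fin N))} {a : Fin n → EuclideanSpace ℝ (Fin N)}

/- The inversion `y ↦ ‖y‖⁻² y` maps the pair `x - a_i`, `x - a_j` to points at distance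
`‖a_i - a_j‖ / (‖x - a_i‖ ‖x - a_j‖)`. -/
theorem regularizedPotential_zero {x : EuclideanSpace ℝ (Fin N)} (hx : ∀ i, x ≠ a i) :
    regularizedPotential a 0 x = potential a x := by
  have hr : ∀ i, ‖x - a i‖ ≠ 0 := fun i => norm_ne_zero_iff.mpr (sub_ne_zero.mpr (hx i))
  have hnorm : ∀ i, ‖(‖x - a i‖ ^ 2)⁻¹ • (x - a i)‖ ^ 2 = (‖x - a i‖ ^ 2)⁻¹ := fun i => by
    have := hr i
    rw [norm_smul, norm_inv, norm_pow, norm_norm]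
    field_simp
  have h := sum_Ioi_norm_sub_sq fun i => (‖x - a i‖ ^ 2)⁻¹ • (x - a i)
  simp only [hnorm] at h
  simp only [regularizedPotential, poleSum, poleField, add_zero, Fintype.card_fin]
  rw [← h, potential]
  refine Finset.sum_congr rfl fun i _ => Finset.sum_congr rfl fun j _ => ?_
  have hdist := dist_div_norm_sq_smul (sub_ne_zero.mpr (hx i)) (sub_ne_zero.mpr (hx j)) 1
  simp only [one_pow, inv_pow, one_div, dist_eq_norm, sub_sub_sub_cancel_left] at hdist
  have := hr i
  have := hr j
  rw [hdist, norm_sub_rev (a j)]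
  field_simp

theorem tendsto_regularizedPotential {x : EuclideanSpace ℝ (Fin N)} (hx : ∀ i, x ≠ a i) :
    Tendsto (fun ε => regularizedPotential a ε x) (𝓝 0) (𝓝 (potential a x)) := by
  rw [← regularizedPotential_zero hx]
  exact (continuousAt_regularizedPotential (z := (x, 0)) fun i => by
    simpa [sub_eq_zero] using hx i).comp (f := fun ε => (x, ε)) (by fun_prop)

theorem ae_forall_ne_pole {α ι : Type*} [MeasurableSpace α] [Countable ι] (μ : Measure α)
    [NullSingletonClass μ] (a : ι → α) : ∀ᵐ x ∂μ, ∀ i, x ≠ a i :=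
  ae_all_iff.mpr fun i => Measure.ae_ne μ (a i)

theorem measurable_potential (a : Fin n → EuclideanSpace ℝ (Fin N)) :
    Measurable (potential a) := by
  unfold potential
  fun_prop

theorem potential_pos (hn : 2 ≤ n) (ha : Function.Injective a) {x : EuclideanSpace ℝ (Fin N)}
    (hx : ∀ i, x ≠ a i) : 0 < potential a x := by
  have hr : ∀ i, 0 < ‖x - a i‖ := fun i => norm_pos_iff.mpr (sub_ne_zero.mpr (hx i))
  let i : Fin n := ⟨0, by omega⟩
  let j : Fin n := ⟨1, by omega⟩
  have hij : i < j := by simp [i, j, Fin.lt_def]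
  have haij : 0 < ‖a i - a j‖ := norm_pos_iff.mpr (sub_ne_zero.mpr (ha.ne hij.ne))
  have hi := hr i
  have hj := hr j
  exact Finset.sum_pos' (fun i _ => Finset.sum_nonneg fun j _ => by positivity)
    ⟨i, Finset.mem_univ _, Finset.sum_pos' (fun j _ => by positivity)
      ⟨j, Finset.mem_Ioi.mpr hij, by positivity⟩⟩

theorem lintegral_ofReal_norm_sq {α F : Type*} [MeasurableSpace α] {μ : Measure α}
    [NormedAddCommGroup F] (f : α → F) :
    ∫⁻ x, ENNReal.ofReal (‖f x‖ ^ 2) ∂μ = eLpNorm f 2 μ ^ 2 := by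
  have h := eLpNorm_nnreal_pow_eq_lintegral (f := f) (p := 2) (μ := μ) two_ne_zero
  simp only [NNReal.coe_ofNat, ENNReal.coe_ofNat, ENNReal.rpow_ofNat] at h
  rw [h]
  exact lintegral_congr fun x => by rw [ENNReal.ofReal_pow (norm_nonneg _), ofReal_norm]

theorem sobolevExponent_ne_zero (hN : 3 ≤ N) : sobolevExponent N ≠ 0 := by
  have hN' : (3 : ℝ) ≤ N := by exact_mod_cast hN
  rw [sobolevExponent, ENNReal.ofReal_ne_zero_iff]
  exact div_pos (by linarith) (by linarith)

theorem tendsto_eLpNorm_of_tendsto_eLpNorm_sub {α F ι : Type*} [MeasurableSpace α] {μ : Measure α}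
    [NormedAddCommGroup F] {p : ℝ≥0∞} [Fact (1 ≤ p)] {l : Filter ι} {f : ι → α → F} {g : α → F}
    (hf : ∀ k, MemLp (f k) p μ) (hg : MemLp g p μ)
    (h : Tendsto (fun k => eLpNorm (fun x => f k x - g x) p μ) l (𝓝 0)) :
    Tendsto (fun k => eLpNorm (f k) p μ) l (𝓝 (eLpNorm g p μ)) := by
  simpa only [Lp.enorm_toLp] using
    ((Lp.tendsto_Lp_iff_tendsto_eLpNorm'' f hf g hg).mpr h).enorm

theorem memLp_gradient_testFunction (φ : 𝓓(Ω, ℝ)) (p : ℝ≥0∞) :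
    MemLp (gradient φ) p (volume.restrict Ω) :=
  ((continuous_gradient (φ.contDiff.of_le (by simp))).memLp_of_hasCompactSupport
    (hasCompactSupport_gradient φ.hasCompactSupport)).restrict _

theorem MemD12.exists_tendsto_ae (hN : 3 ≤ N) {u : EuclideanSpace ℝ (Fin N) → ℝ}
    {G : EuclideanSpace ℝ (Fin N) → EuclideanSpace ℝ (Fin N)} (hu : MemD12 Ω u G) :
    ∃ φ : ℕ → 𝓓(Ω, ℝ),
      (∀ᵐ x ∂volume.restrict Ω, Tendsto (fun k => φ k x) atTop (𝓝 (u x))) ∧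
      Tendsto (fun k => ∫⁻ x in Ω, ENNReal.ofReal (‖gradient (φ k) x‖ ^ 2)) atTop
        (𝓝 (∫⁻ x in Ω, ENNReal.ofReal (‖G x‖ ^ 2))) := by
  obtain ⟨φ, hφu, hφG⟩ := hu.approx
  obtain ⟨s, hs, hφs⟩ := (tendstoInMeasure_of_tendsto_eLpNorm (f := fun k => ⇑(φ k))
    (sobolevExponent_ne_zero hN) (fun k => (φ k).continuous.aestronglyMeasurable)
    hu.memLp.1 hφu).exists_seq_tendsto_ae
  refine ⟨φ ∘ s, hφs, ?_⟩
  simp_rw [lintegral_ofReal_norm_sq]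
  exact ((ENNReal.continuous_pow 2).tendsto _).comp (tendsto_eLpNorm_of_tendsto_eLpNorm_sub
    (fun k => memLp_gradient_testFunction (φ (s k)) 2) hu.memLp_grad (hφG.comp hs.tendsto_atTop))

theorem MemD12.lintegral_potential_mul_sq_ne_zero (hN : 3 ≤ N) (hn : 2 ≤ n)
    (ha : Function.Injective a) {u : EuclideanSpace ℝ (Fin N) → ℝ}
    {G : EuclideanSpace ℝ (Fin N) → EuclideanSpace ℝ (Fin N)} (hu : MemD12 Ω u G)
    (hu0 : ¬ u =ᵐ[volume.restrict Ω] 0) :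
    ∫⁻ x in Ω, ENNReal.ofReal (potential a x * u x ^ 2) ≠ 0 := by
  have : NeZero N := ⟨by omega⟩
  have hmeasV := measurable_potential a
  have hmeasu := hu.memLp.1.aemeasurable
  rw [Ne, lintegral_eq_zero_iff' (by fun_prop)]
  contrapose! hu0
  filter_upwards [hu0, ae_restrict_of_ae (ae_forall_ne_pole volume a)] with x hx hxa
  have hle : potential a x * u x ^ 2 ≤ 0 := by simpa using hx
  exact pow_eq_zero_iff two_ne_zero |>.mp
    ((nonpos_of_mul_nonpos_right hle (potential_pos hn ha hxa)).antisymm (sq_nonneg _))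

/- Fatou's lemma is applied once, the regularization and the approximation by test functions being
removed together. -/
theorem MemD12.mul_lintegral_potential_mul_sq_le (hN : 3 ≤ N) {c : ℝ}
    (h : ∀ ε ∈ Set.Ioc (0 : ℝ) 1, ∀ φ : 𝓓(Ω, ℝ),
      ∫⁻ x in Ω, ENNReal.ofReal (c * regularizedPotential a ε x * φ x ^ 2)
        ≤ ∫⁻ x in Ω, ENNReal.ofReal (‖gradient φ x‖ ^ 2))
    {u : EuclideanSpace ℝ (Fin N) → ℝ} {G : EuclideanSpace ℝ (Fin N) → EuclideanSpace ℝ (Fin N)}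
    (hu : MemD12 Ω u G) :
    ∫⁻ x in Ω, ENNReal.ofReal (c * potential a x * u x ^ 2)
      ≤ ∫⁻ x in Ω, ENNReal.ofReal (‖G x‖ ^ 2) := by
  have : NeZero N := ⟨by omega⟩
  obtain ⟨φ, hφu, hφG⟩ := hu.exists_tendsto_ae hN
  let ε : ℕ → ℝ := fun k => 1 / ((k : ℝ) + 1)
  have hε : ∀ k, ε k ∈ Set.Ioc (0 : ℝ) 1 := fun k =>
    ⟨by positivity, div_le_one_of_le₀ (by simp) (by positivity)⟩
  calc ∫⁻ x in Ω, ENNReal.ofReal (c * potential a x * u x ^ 2)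
      = ∫⁻ x in Ω, liminf (fun k => ENNReal.ofReal
          (c * regularizedPotential a (ε k) x * φ k x ^ 2)) atTop := by
        refine lintegral_congr_ae ?_
        filter_upwards [hφu, ae_restrict_of_ae (ae_forall_ne_pole volume a)] with x hx hxa
        exact (ENNReal.tendsto_ofReal
          ((((tendsto_regularizedPotential hxa).comp
            tendsto_one_div_add_atTop_nhds_zero_nat).const_mul c).mul (hx.pow 2))).liminf_eq.symm
    _ ≤ liminf (fun k => ∫⁻ x in Ω, ENNReal.ofReal
          (c * regularizedPotential a (ε k) x * φ k x ^ 2)) atTop := by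
        refine lintegral_liminf_le fun k => ?_
        have hφk := (φ k).continuous.measurable
        have hX := (continuous_regularizedPotential a (hε k).1).measurable
        fun_prop
    _ ≤ liminf (fun k => ∫⁻ x in Ω, ENNReal.ofReal (‖gradient (φ k) x‖ ^ 2)) atTop :=
        liminf_le_liminf (Eventually.of_forall fun k => h (ε k) (hε k) (φ k))
    _ = ∫⁻ x in Ω, ENNReal.ofReal (‖G x‖ ^ 2) := hφG.liminf_eq

theorem ofReal_le_hardyConstant (hN : 3 ≤ N) (hn : 2 ≤ n) (ha : Function.Injective a) {c : ℝ}
    (hc : 0 ≤ c) (h : ∀ ε ∈ Set.Ioc (0 : ℝ) 1, ∃ F, ContDiff ℝ 1 F ∧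
      ∀ x ∈ Ω, c * regularizedPotential a ε x ≤ hardyDensity F x) :
    ENNReal.ofReal c ≤ hardyConstant Ω a := by
  have hφ : ∀ ε ∈ Set.Ioc (0 : ℝ) 1, ∀ φ : 𝓓(Ω, ℝ),
      ∫⁻ x in Ω, ENNReal.ofReal (c * regularizedPotential a ε x * φ x ^ 2)
        ≤ ∫⁻ x in Ω, ENNReal.ofReal (‖gradient φ x‖ ^ 2) := fun ε hε φ => by
    obtain ⟨F, hF, hle⟩ := h ε hε
    calc ∫⁻ x in Ω, ENNReal.ofReal (c * regularizedPotential a ε x * φ x ^ 2)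
        ≤ ∫⁻ x in Ω, ENNReal.ofReal (hardyDensity F x * φ x ^ 2) :=
          setLIntegral_mono' Ω.isOpen.measurableSet fun x hx => by
            gcongr
            exact hle x hx
      _ ≤ ∫⁻ x in Ω, ENNReal.ofReal (‖gradient φ x‖ ^ 2) :=
          setLIntegral_hardyDensity_mul_sq_le φ hF fun x hx =>
            (mul_nonneg hc (regularizedPotential_nonneg a hε.1.le x)).trans (hle x hx)
  refine le_sInf ?_
  rintro _ ⟨u, G, hu, hu0, rfl⟩
  have hfinite : ∫⁻ x in Ω, ENNReal.ofReal (‖G x‖ ^ 2) ≠ ∞ := by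
    rw [lintegral_ofReal_norm_sq]
    exact ENNReal.pow_ne_top hu.memLp_grad.2.ne
  rw [ENNReal.le_div_iff_mul_le (Or.inl (hu.lintegral_potential_mul_sq_ne_zero hN hn ha hu0))
    (Or.inr hfinite), ← lintegral_const_mul' _ _ ENNReal.ofReal_ne_top]
  simp_rw [← ENNReal.ofReal_mul hc, ← mul_assoc]
  exact hu.mul_lintegral_potential_mul_sq_le hN hφ

theorem finrank_euclideanSpace_sub_two (hn : n ≠ 0) :
    (Module.finrank ℝ (EuclideanSpace ℝ (Fin N)) : ℝ) - 2
      = Fintype.card (Fin n) * (((N : ℝ) - 2) / n) := by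
  have : (n : ℝ) ≠ 0 := by exact_mod_cast hn
  simp only [finrank_euclideanSpace, Fintype.card_fin]
  field_simp

theorem le_hardyConstant (hN : 3 ≤ N) (hn : 2 ≤ n) (Ω : Opens (EuclideanSpace ℝ (Fin N)))
    (ha : Function.Injective a) :
    ENNReal.ofReal (((N : ℝ) - 2) ^ 2 / (n : ℝ) ^ 2) ≤ hardyConstant Ω a := by
  have hN' : (3 : ℝ) ≤ N := by exact_mod_cast hN
  rw [← div_pow]
  exact ofReal_le_hardyConstant hN hn ha (sq_nonneg _) fun ε hε =>
    ⟨_, (contDiff_poleField a hε.1).const_smul _, fun x _ =>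
      sq_mul_regularizedPotential_le_hardyDensity a (div_nonneg (by linarith) n.cast_nonneg)
        (finrank_euclideanSpace_sub_two (by omega)) hε.1 x⟩

theorem lt_hardyConstant (hN : 3 ≤ N) (hn : 3 ≤ n)
    (hΩ : Bornology.IsBounded (Ω : Set (EuclideanSpace ℝ (Fin N)))) (ha : Function.Injective a) :
    ENNReal.ofReal (((N : ℝ) - 2) ^ 2 / (n : ℝ) ^ 2) < hardyConstant Ω a := by
  have hN' : (3 : ℝ) ≤ N := by exact_mod_cast hN
  have hn' : (3 : ℝ) ≤ n := by exact_mod_cast hn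
  obtain ⟨c, hc, hF⟩ := exists_lt_forall_exists_le_hardyDensity ha (by simpa using hn)
    hΩ.isCompact_closure (β := ((N : ℝ) - 2) / n) (div_pos (by linarith) (by linarith))
    (finrank_euclideanSpace_sub_two (by omega))
  have hc0 : 0 < c := (sq_nonneg _).trans_lt hc
  rw [← div_pow]
  refine ((ENNReal.ofReal_lt_ofReal_iff hc0).mpr hc).trans_le ?_
  refine ofReal_le_hardyConstant hN (by omega) ha hc0.le fun ε hε => ?_
  obtain ⟨F, hFsmooth, hle⟩ := hF ε hε
  exact ⟨F, hFsmooth, fun x hx => hle x (subset_closure hx)⟩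

end Potential

section InvNormPow

variable {E : Type*} [NormedAddCommGroup E] [NormedSpace ℝ E] [FiniteDimensional ℝ E]
  [Nontrivial E] [MeasurableSpace E] [BorelSpace E] (μ : Measure E) [μ.IsAddHaarMeasure]

theorem not_integrableOn_ball_inv_norm_pow_finrank {R : ℝ} (hR : 0 < R) :
    ¬ IntegrableOn (fun x : E => (‖x‖ ^ Module.finrank ℝ E)⁻¹) (Metric.ball 0 R) μ := by
  rw [integrableOn_fun_norm_addHaar μ (f := fun y : ℝ => (y ^ Module.finrank ℝ E)⁻¹)]
  intro h
  have hinv : IntegrableOn (fun y : ℝ => y⁻¹) (Set.Ioo 0 R) := by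
    refine h.congr_fun (fun y hy => ?_) measurableSet_Ioo
    have hy0 : y ≠ 0 := hy.1.ne'
    obtain ⟨k, hk⟩ := Nat.exists_eq_add_of_lt (Module.finrank_pos (R := ℝ) (M := E))
    simp only [hk, smul_eq_mul, zero_add, Nat.add_sub_cancel]
    field_simp
    exact (pow_succ y k).symm
  rw [← intervalIntegrable_iff_integrableOn_Ioo_of_le hR.le] at hinv
  exact (intervalIntegrable_inv_iff.mp hinv).elim hR.ne fun h0 => h0 Set.left_mem_uIcc

theorem lintegral_ball_inv_norm_pow_finrank (b : E) {R : ℝ} (hR : 0 < R) :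
    ∫⁻ x in Metric.ball b R, ENNReal.ofReal ((‖x - b‖ ^ Module.finrank ℝ E)⁻¹) ∂μ = ∞ := by
  have horigin :
      ∫⁻ x in Metric.ball 0 R, ENNReal.ofReal ((‖x‖ ^ Module.finrank ℝ E)⁻¹) ∂μ = ∞ := by
    by_contra h
    refine not_integrableOn_ball_inv_norm_pow_finrank μ hR ⟨by fun_prop, ?_⟩
    rw [hasFiniteIntegral_iff_ofReal (Eventually.of_forall fun x => by positivity)]
    exact lt_top_iff_ne_top.mpr h
  rw [← horigin, ← lintegral_indicator Metric.isOpen_ball.measurableSet,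
    ← lintegral_indicator Metric.isOpen_ball.measurableSet,
    ← lintegral_sub_right_eq_self ((Metric.ball (0 : E) R).indicator _) b]
  exact lintegral_congr fun x => by simp [Set.indicator, dist_eq_norm]

end InvNormPow

section Bubble

variable {E : Type*} [NormedAddCommGroup E]

/-- The regularized virtual ground state `(|x - b|² + ε) ^ (-p)` of the Hardy inequality with pole
`b`, which is critical for `p = (N - 2) / 4`. -/
def bubble (b : E) (p ε : ℝ) (x : E) : ℝ := (‖x - b‖ ^ 2 + ε) ^ (-p)

theorem bubble_pos (b : E) (p : ℝ) {ε : ℝ} (hε : 0 < ε) (x : E) : 0 < bubble b p ε x := by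
  unfold bubble
  positivity

theorem bubble_le (b : E) {p : ℝ} (hp : 0 ≤ p) {ε ρ : ℝ} (hε : 0 ≤ ε) (hρ : 0 < ρ) {x : E}
    (hx : ρ ≤ ‖x - b‖) : bubble b p ε x ≤ (ρ ^ 2) ^ (-p) :=
  Real.rpow_le_rpow_of_nonpos (by positivity) (by nlinarith) (by linarith)

theorem norm_mul_bubble_add_one_le (b : E) (p : ℝ) {ε : ℝ} (hε : 0 < ε) (x : E) :
    ‖x - b‖ * bubble b (p + 1) ε x ≤ ‖x - b‖⁻¹ * bubble b p ε x := by
  have hbubble : bubble b (p + 1) ε x = (‖x - b‖ ^ 2 + ε)⁻¹ * bubble b p ε x := by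
    rw [bubble, neg_add', Real.rpow_sub_one (by positivity), bubble, div_eq_inv_mul]
  rw [hbubble, ← mul_assoc]
  refine mul_le_mul_of_nonneg_right ?_ (bubble_pos b p hε x).le
  rcases (norm_nonneg (x - b)).eq_or_lt with hr | hr
  · simp [← hr]
  · rw [← div_eq_mul_inv, ← one_div, div_le_div_iff₀ (by positivity) hr]
    linarith

theorem tendsto_norm_mul_bubble_sq {b x : E} (hx : x ≠ b) (d : ℕ) :
    Tendsto (fun ε => (‖x - b‖ * bubble b (((d : ℝ) - 2) / 4 + 1) ε x) ^ 2) (𝓝 0)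
      (𝓝 (‖x - b‖ ^ d)⁻¹) := by
  have hr : 0 < ‖x - b‖ := norm_pos_iff.mpr (sub_ne_zero.mpr hx)
  have hbase : ContinuousAt (fun ε : ℝ => ‖x - b‖ ^ 2 + ε) 0 := by fun_prop
  have hcont : ContinuousAt
      (fun ε => (‖x - b‖ * bubble b (((d : ℝ) - 2) / 4 + 1) ε x) ^ 2) 0 :=
    (continuousAt_const.mul (hbase.rpow_const (Or.inl (by positivity)))).pow 2
  have hvalue : (‖x - b‖ * bubble b (((d : ℝ) - 2) / 4 + 1) 0 x) ^ 2 = (‖x - b‖ ^ d)⁻¹ := by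
    rw [bubble, add_zero, mul_pow, ← Real.rpow_mul_natCast (sq_nonneg _),
      ← Real.rpow_natCast _ 2, ← Real.rpow_mul hr.le, ← Real.rpow_add hr,
      ← Real.rpow_natCast _ d, ← Real.rpow_neg hr.le]
    congr 1
    push_cast
    ring
  simpa only [hvalue] using hcont.tendsto

variable [InnerProductSpace ℝ E]

theorem contDiff_bubble (b : E) (p : ℝ) {ε : ℝ} (hε : 0 < ε) {m : WithTop ℕ∞} :
    ContDiff ℝ m (bubble b p ε) :=
  (contDiff_norm_sub_sq_add b ε).rpow_const_of_ne fun y => by positivity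

theorem norm_fderiv_bubble (b : E) {p : ℝ} (hp : 0 ≤ p) {ε : ℝ} (hε : 0 < ε) (x : E) :
    ‖fderiv ℝ (bubble b p ε) x‖ = 2 * p * (‖x - b‖ * bubble b (p + 1) ε x) := by
  have h : HasFDerivAt (bubble b p ε)
      ((-p * (‖x - b‖ ^ 2 + ε) ^ (-p - 1)) • (2 • innerSL ℝ (x - b))) x :=
    (hasFDerivAt_norm_sub_sq_add b ε x).rpow_const (Or.inl (by positivity))
  have hbubble : (‖x - b‖ ^ 2 + ε) ^ (-p - 1) = bubble b (p + 1) ε x := by rw [bubble, neg_add']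
  rw [h.fderiv, hbubble, norm_smul, ← Nat.cast_smul_eq_nsmul ℝ, norm_smul, innerSL_apply_norm,
    norm_mul, norm_neg, Real.norm_of_nonneg hp, Real.norm_of_nonneg (bubble_pos b _ hε x).le,
    Nat.cast_ofNat, Real.norm_ofNat]
  ring

variable [FiniteDimensional ℝ E] {b : E} (χ : ContDiffBump b) {Ω : Opens E}

/-- The bubble cut off by `χ`, as a test function on `Ω`. -/
def truncatedBubble (hχ : Metric.closedBall b χ.rOut ⊆ Ω) (p : ℝ) {ε : ℝ} (hε : 0 < ε) :
    𝓓(Ω, ℝ) where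
  toFun x := χ x * bubble b p ε x
  contDiff' := χ.contDiff.mul (contDiff_bubble b p hε)
  hasCompactSupport' := χ.hasCompactSupport.mul_right
  tsupport_subset' _ hx := hχ (χ.tsupport_eq ▸ tsupport_mul_subset_left hx)

variable {χ} (hχ : Metric.closedBall b χ.rOut ⊆ Ω) {p ε : ℝ}

theorem truncatedBubble_of_mem_ball (p : ℝ) (hε : 0 < ε) {x : E} (hx : x ∈ Metric.ball b χ.rIn) :
    truncatedBubble χ hχ p hε x = bubble b p ε x := by
  change χ x * bubble b p ε x = bubble b p ε x
  rw [χ.one_of_mem_closedBall (Metric.ball_subset_closedBall hx), one_mul]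

theorem norm_gradient_truncatedBubble_of_mem_ball (hp : 0 ≤ p) (hε : 0 < ε) {x : E}
    (hx : x ∈ Metric.ball b χ.rIn) :
    ‖gradient (truncatedBubble χ hχ p hε) x‖ = 2 * p * (‖x - b‖ * bubble b (p + 1) ε x) := by
  have heq : truncatedBubble χ hχ p hε =ᶠ[𝓝 x] bubble b p ε := by
    filter_upwards [Metric.isOpen_ball.mem_nhds hx] with y hy
    exact truncatedBubble_of_mem_ball hχ p hε hy
  rw [gradient, LinearIsometryEquiv.norm_map, heq.fderiv_eq, norm_fderiv_bubble b hp hε]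

theorem exists_norm_gradient_truncatedBubble_le (hp : 0 ≤ p) :
    ∃ C, ∀ ε (hε : 0 < ε), ∀ x ∉ Metric.ball b χ.rIn,
      ‖gradient (truncatedBubble χ hχ p hε) x‖ ≤ C := by
  have hsmooth : ContDiff ℝ 1 χ := χ.contDiff
  have hrIn := χ.rIn_pos
  obtain ⟨L, hL⟩ := (hsmooth.continuous_fderiv one_ne_zero).bounded_above_of_compact_support
    (χ.hasCompactSupport.fderiv ℝ)
  refine ⟨2 * p * (χ.rIn⁻¹ * (χ.rIn ^ 2) ^ (-p)) + (χ.rIn ^ 2) ^ (-p) * L, fun ε hε x hx => ?_⟩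
  have hxb : χ.rIn ≤ ‖x - b‖ := by simpa [dist_eq_norm] using hx
  have hbubble : bubble b p ε x ≤ (χ.rIn ^ 2) ^ (-p) := bubble_le b hp hε.le hrIn hxb
  have hpos := bubble_pos b p hε x
  have hpos' := bubble_pos b (p + 1) hε x
  have hderiv : HasFDerivAt (truncatedBubble χ hχ p hε)
      (χ x • fderiv ℝ (bubble b p ε) x + bubble b p ε x • fderiv ℝ χ x) x :=
    (hsmooth.differentiable one_ne_zero x).hasFDerivAt.mul
      ((contDiff_bubble b p hε (m := 1)).differentiable one_ne_zero x).hasFDerivAt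
  rw [gradient, LinearIsometryEquiv.norm_map, hderiv.fderiv]
  refine (norm_add_le _ _).trans (add_le_add ?_ ?_)
  · calc ‖χ x • fderiv ℝ (bubble b p ε) x‖
        = χ x * (2 * p * (‖x - b‖ * bubble b (p + 1) ε x)) := by
          rw [norm_smul, norm_fderiv_bubble b hp hε, Real.norm_of_nonneg χ.nonneg]
      _ ≤ 2 * p * (‖x - b‖ * bubble b (p + 1) ε x) :=
          mul_le_of_le_one_left (by positivity) χ.le_one
      _ ≤ 2 * p * (‖x - b‖⁻¹ * bubble b p ε x) := by
          gcongr 2 * p * ?_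
          exact norm_mul_bubble_add_one_le b p hε x
      _ ≤ 2 * p * (χ.rIn⁻¹ * (χ.rIn ^ 2) ^ (-p)) := by gcongr
  · rw [norm_smul, Real.norm_of_nonneg hpos.le]
    gcongr
    exact hL x

variable [MeasurableSpace E] [BorelSpace E]

theorem exists_lintegral_gradient_truncatedBubble_le (hp : 0 ≤ p) :
    ∃ C ≠ ∞, ∀ ε (hε : 0 < ε),
      ∫⁻ x in Ω, ENNReal.ofReal (‖gradient (truncatedBubble χ hχ p hε) x‖ ^ 2)
        ≤ ENNReal.ofReal ((2 * p) ^ 2) * (∫⁻ x in Metric.ball b χ.rIn,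
            ENNReal.ofReal ((‖x - b‖ * bubble b (p + 1) ε x) ^ 2)) + C := by
  obtain ⟨D, hD⟩ := exists_norm_gradient_truncatedBubble_le hχ hp
  refine ⟨ENNReal.ofReal (D ^ 2) * volume (Metric.closedBall b χ.rOut),
    ENNReal.mul_ne_top ENNReal.ofReal_ne_top measure_closedBall_lt_top.ne, fun ε hε => ?_⟩
  let f : E → ℝ≥0∞ := fun x => ENNReal.ofReal (‖gradient (truncatedBubble χ hχ p hε) x‖ ^ 2)
  have hsupport : Function.support f ⊆ Metric.closedBall b χ.rOut := fun x hx => by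
    rw [← χ.tsupport_eq]
    refine tsupport_mul_subset_left (g := bubble b p ε) (support_fderiv_subset ℝ fun h => hx ?_)
    have hfderiv : fderiv ℝ (truncatedBubble χ hχ p hε) x = 0 := h
    simp only [f, gradient, hfderiv, map_zero, norm_zero]
    simp
  calc ∫⁻ x in Ω, f x ≤ ∫⁻ x, f x := setLIntegral_le_lintegral _ _
    _ = ∫⁻ x in Metric.closedBall b χ.rOut, f x :=
        (setLIntegral_eq_of_support_subset hsupport).symm
    _ = (∫⁻ x in Metric.closedBall b χ.rOut ∩ Metric.ball b χ.rIn, f x)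
          + ∫⁻ x in Metric.closedBall b χ.rOut \ Metric.ball b χ.rIn, f x :=
        (lintegral_inter_add_sdiff _ _ Metric.isOpen_ball.measurableSet).symm
    _ ≤ (∫⁻ x in Metric.ball b χ.rIn, f x)
          + ∫⁻ x in Metric.closedBall b χ.rOut \ Metric.ball b χ.rIn, ENNReal.ofReal (D ^ 2) := by
        refine add_le_add (lintegral_mono_set Set.inter_subset_right) (setLIntegral_mono'
          (Metric.isClosed_closedBall.measurableSet.diff Metric.isOpen_ball.measurableSet)
          fun x hx => ?_)
        gcongr ENNReal.ofReal (?_ ^ 2)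
        exact hD ε hε x hx.2
    _ ≤ _ := by
        rw [setLIntegral_const, ← lintegral_const_mul' _ _ ENNReal.ofReal_ne_top]
        gcongr ?_ + _ * volume ?_
        · refine (setLIntegral_congr_fun Metric.isOpen_ball.measurableSet fun x hx => ?_).le
          simp only [f]
          rw [norm_gradient_truncatedBubble_of_mem_ball hχ hp hε hx, mul_pow,
            ENNReal.ofReal_mul (by positivity)]
        · exact Set.sdiff_subset

theorem lintegral_ball_norm_mul_bubble_sq_ne_top (b : E) (p R : ℝ) {ε : ℝ} (hε : 0 < ε) :
    ∫⁻ x in Metric.ball b R, ENNReal.ofReal ((‖x - b‖ * bubble b p ε x) ^ 2) ≠ ∞ := by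
  have hbubble := (contDiff_bubble b p hε (m := 0)).continuous
  have hint : IntegrableOn (fun x => (‖x - b‖ * bubble b p ε x) ^ 2) (Metric.ball b R) :=
    ((by fun_prop : Continuous fun x => (‖x - b‖ * bubble b p ε x) ^ 2).continuousOn
      |>.integrableOn_compact (isCompact_closedBall b R)).mono_set Metric.ball_subset_closedBall
  exact ((hasFiniteIntegral_iff_ofReal (Eventually.of_forall fun x => sq_nonneg _)).mp hint.2).ne

theorem tendsto_lintegral_ball_norm_mul_bubble_sq [Nontrivial E] (b : E) {R : ℝ} (hR : 0 < R)
    {ε : ℕ → ℝ} (hε : ∀ k, 0 < ε k) (hlim : Tendsto ε atTop (𝓝 0)) :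
    Tendsto (fun k => ∫⁻ x in Metric.ball b R, ENNReal.ofReal
      ((‖x - b‖ * bubble b (((Module.finrank ℝ E : ℝ) - 2) / 4 + 1) (ε k) x) ^ 2))
      atTop (𝓝 ∞) := by
  refine tendsto_of_le_liminf_of_limsup_le ?_ le_top
  calc ∞ = ∫⁻ x in Metric.ball b R, ENNReal.ofReal ((‖x - b‖ ^ Module.finrank ℝ E)⁻¹) :=
        (lintegral_ball_inv_norm_pow_finrank volume b hR).symm
    _ = ∫⁻ x in Metric.ball b R, liminf (fun k => ENNReal.ofReal
          ((‖x - b‖ * bubble b (((Module.finrank ℝ E : ℝ) - 2) / 4 + 1) (ε k) x) ^ 2)) atTop := by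
        refine lintegral_congr_ae ?_
        filter_upwards [ae_restrict_of_ae (Measure.ae_ne volume b)] with x hx
        exact (ENNReal.tendsto_ofReal
          ((tendsto_norm_mul_bubble_sq hx _).comp hlim)).liminf_eq.symm
    _ ≤ _ := lintegral_liminf_le fun k => by
        have := (contDiff_bubble b (((Module.finrank ℝ E : ℝ) - 2) / 4 + 1) (hε k)
          (m := 0)).continuous.measurable
        fun_prop

end Bubble

section UpperBound

theorem le_of_mul_le_mul_add_of_tendsto_top {α : Type*} {l : Filter α} [l.NeBot]
    {x y C : ℝ≥0∞} (hC : C ≠ ∞) {A : α → ℝ≥0∞} (hA : Tendsto A l (𝓝 ∞)) (hfinite : ∀ k, A k ≠ ∞)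
    (hle : ∀ k, x * A k ≤ y * A k + C) : x ≤ y := by
  have hlim : Tendsto (fun k => y + C / A k) l (𝓝 y) := by
    simpa using (ENNReal.Tendsto.const_div hA (Or.inr hC)).const_add y
  refine ge_of_tendsto hlim ?_
  filter_upwards [hA.eventually_ne (b₂ := 0) ENNReal.top_ne_zero] with k hk
  calc x ≤ (y * A k + C) / A k := by
        rw [ENNReal.le_div_iff_mul_le (Or.inl hk) (Or.inl (hfinite k))]
        exact hle k
    _ = y + C / A k := by rw [ENNReal.add_div, ENNReal.mul_div_cancel_right hk (hfinite k)]

variable {N n : ℕ} {Ω : Opens (EuclideanSpace ℝ (Fin N))} {a : Fin n → EuclideanSpace ℝ (Fin N)}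

theorem memD12_testFunction (φ : 𝓓(Ω, ℝ)) : MemD12 Ω φ (gradient φ) where
  memLp := (φ.continuous.memLp_of_hasCompactSupport φ.hasCompactSupport).restrict _
  memLp_grad := memLp_gradient_testFunction φ 2
  weakGradient := by
    intro ψ v
    have hDφ : Continuous (fderiv ℝ φ) := φ.contDiff.continuous_fderiv (by simp)
    have hDψ : Continuous (fderiv ℝ ψ) := ψ.contDiff.continuous_fderiv (by simp)
    have hinner : ∀ x, inner ℝ (gradient φ x) v = fderiv ℝ φ x v := fun x => by simp [gradient]
    simp_rw [hinner]
    rw [setIntegral_eq_integral_of_forall_compl_eq_zero fun x hx => by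
        rw [testFunction_apply_eq_zero φ hx, zero_mul],
      setIntegral_eq_integral_of_forall_compl_eq_zero fun x hx => by
        rw [testFunction_apply_eq_zero ψ hx, mul_zero]]
    refine integral_mul_fderiv_eq_neg_fderiv_mul_of_integrable ?_ ?_ ?_
      (fun x _ => φ.contDiff.differentiable (by simp) x)
      (fun x _ => ψ.contDiff.differentiable (by simp) x)
    · exact Continuous.integrable_of_hasCompactSupport (by fun_prop) ψ.hasCompactSupport.mul_left
    · exact Continuous.integrable_of_hasCompactSupport (by fun_prop) φ.hasCompactSupport.mul_right
    · exact Continuous.integrable_of_hasCompactSupport (by fun_prop) ψ.hasCompactSupport.mul_left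
  approx := ⟨fun _ => φ, by simp, by simp⟩

theorem hardyConstant_mul_lintegral_le (a : Fin n → EuclideanSpace ℝ (Fin N)) (φ : 𝓓(Ω, ℝ)) :
    hardyConstant Ω a * ∫⁻ x in Ω, ENNReal.ofReal (potential a x * φ x ^ 2)
      ≤ ∫⁻ x in Ω, ENNReal.ofReal (‖gradient φ x‖ ^ 2) := by
  by_cases hφ : φ =ᵐ[volume.restrict Ω] 0
  · have hzero : ∫⁻ x in Ω, ENNReal.ofReal (potential a x * φ x ^ 2) = 0 :=
      (lintegral_congr_ae (hφ.mono fun x hx => by simp [hx])).trans lintegral_zero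
    simp [hzero]
  · exact ENNReal.mul_le_of_le_div (sInf_le ⟨φ, gradient φ, memD12_testFunction φ, hφ, rfl⟩)

theorem mul_lintegral_ball_le_lintegral_potential {b : EuclideanSpace ℝ (Fin N)}
    [NeZero N] {χ : ContDiffBump b} (hχ : Metric.closedBall b χ.rOut ⊆ Ω) {c : ℝ} (hc : 0 ≤ c)
    (hV : ∀ x ∈ Metric.closedBall b χ.rOut, x ≠ b → c * (‖x - b‖ ^ 2)⁻¹ ≤ potential a x)
    (p : ℝ) {ε : ℝ} (hε : 0 < ε) :
    ENNReal.ofReal c * ∫⁻ x in Metric.ball b χ.rIn,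
        ENNReal.ofReal ((‖x - b‖ * bubble b (p + 1) ε x) ^ 2)
      ≤ ∫⁻ x in Ω, ENNReal.ofReal (potential a x * truncatedBubble χ hχ p hε x ^ 2) := by
  have hball : Metric.ball b χ.rIn ⊆ Metric.closedBall b χ.rOut :=
    (Metric.ball_subset_ball χ.rIn_lt_rOut.le).trans Metric.ball_subset_closedBall
  rw [← lintegral_const_mul' _ _ ENNReal.ofReal_ne_top]
  refine le_trans ?_ (lintegral_mono_set (hball.trans hχ))
  refine setLIntegral_mono_ae' Metric.isOpen_ball.measurableSet ?_
  filter_upwards [Measure.ae_ne volume b] with x hxb hx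
  rw [← ENNReal.ofReal_mul hc, truncatedBubble_of_mem_ball hχ p hε hx]
  refine ENNReal.ofReal_le_ofReal ?_
  have hpos := bubble_pos b (p + 1) hε x
  calc c * (‖x - b‖ * bubble b (p + 1) ε x) ^ 2
      ≤ c * (‖x - b‖⁻¹ * bubble b p ε x) ^ 2 := by
        gcongr c * ?_ ^ 2
        exact norm_mul_bubble_add_one_le b p hε x
    _ = c * (‖x - b‖ ^ 2)⁻¹ * bubble b p ε x ^ 2 := by ring
    _ ≤ potential a x * bubble b p ε x ^ 2 := by
        gcongr
        exact hV x (hball hx) hxb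

theorem hardyConstant_mul_le_of_eventually_le_potential (hN : 3 ≤ N)
    {b : EuclideanSpace ℝ (Fin N)} (hb : b ∈ Ω) {c : ℝ} (hc : 0 ≤ c)
    (hV : ∀ᶠ x in 𝓝[≠] b, c * (‖x - b‖ ^ 2)⁻¹ ≤ potential a x) :
    hardyConstant Ω a * ENNReal.ofReal c ≤ ENNReal.ofReal (((N : ℝ) - 2) ^ 2 / 4) := by
  have : NeZero N := ⟨by omega⟩
  obtain ⟨ρ, hρ, hball⟩ := Metric.nhds_basis_closedBall.eventually_iff.mp
    ((eventually_nhdsWithin_iff.mp hV).and (Ω.isOpen.mem_nhds hb))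
  let χ : ContDiffBump b := ⟨ρ / 2, ρ, by positivity, by linarith⟩
  have hχ : Metric.closedBall b χ.rOut ⊆ Ω := fun x hx => (hball hx).2
  let p : ℝ := ((N : ℝ) - 2) / 4
  have hp : 0 ≤ p := by
    have : (3 : ℝ) ≤ N := by exact_mod_cast hN
    exact div_nonneg (by linarith) (by norm_num)
  let ε : ℕ → ℝ := fun k => 1 / ((k : ℝ) + 1)
  have hε : ∀ k, 0 < ε k := fun k => by positivity
  let A : ℕ → ℝ≥0∞ := fun k => ∫⁻ x in Metric.ball b χ.rIn,
    ENNReal.ofReal ((‖x - b‖ * bubble b (p + 1) (ε k) x) ^ 2)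
  have hA : Tendsto A atTop (𝓝 ∞) := by
    simpa only [finrank_euclideanSpace_fin] using tendsto_lintegral_ball_norm_mul_bubble_sq b
      χ.rIn_pos hε tendsto_one_div_add_atTop_nhds_zero_nat
  obtain ⟨C, hC, hgradient⟩ := exists_lintegral_gradient_truncatedBubble_le hχ hp
  have hle : ∀ k, hardyConstant Ω a * ENNReal.ofReal c * A k
      ≤ ENNReal.ofReal ((2 * p) ^ 2) * A k + C := fun k =>
    calc hardyConstant Ω a * ENNReal.ofReal c * A k
        ≤ hardyConstant Ω a * ∫⁻ x in Ω, ENNReal.ofReal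
            (potential a x * truncatedBubble χ hχ p (hε k) x ^ 2) := by
          rw [mul_assoc]
          gcongr
          exact mul_lintegral_ball_le_lintegral_potential hχ hc (fun x hx => (hball hx).1) p (hε k)
      _ ≤ _ := hardyConstant_mul_lintegral_le a _
      _ ≤ _ := hgradient (ε k) (hε k)
  convert le_of_mul_le_mul_add_of_tendsto_top hC hA
    (fun k => lintegral_ball_norm_mul_bubble_sq_ne_top b _ _ (hε k)) hle using 2
  simp only [p]
  ring

theorem eventually_mul_inv_norm_sub_sq_le_potential (ha : Function.Injective a) (k : Fin n)
    {δ : ℝ} (hδ : 0 < δ) :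
    ∀ᶠ x in 𝓝[≠] a k, ((n : ℝ) - 1 - δ) * (‖x - a k‖ ^ 2)⁻¹ ≤ potential a x := by
  have hfield : ∀ᶠ x in 𝓝 (a k), 0 < ‖x - a k‖ ^ 2 →
      ‖poleField a 0 x‖ ^ 2 ≤ (1 + δ) * (‖x - a k‖ ^ 2)⁻¹ := by
    simpa using (Continuous.prodMk_left (0 : ℝ)).continuousAt.eventually
      (eventually_norm_poleField_sq_le ha k hδ)
  filter_upwards [nhdsWithin_le_nhds hfield, self_mem_nhdsWithin,
    nhdsNE_le_cofinite _ (Set.finite_range a).compl_mem_cofinite] with x hx hxk hxa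
  have hpole : ∀ i, x ≠ a i := fun i hi => hxa ⟨i, hi.symm⟩
  have hsum : n * (‖x - a k‖ ^ 2)⁻¹ ≤ n * poleSum a 0 x := by
    gcongr
    simpa using inv_le_poleSum a le_rfl k x
  have hfield_x := hx (pow_pos (norm_pos_iff.mpr (sub_ne_zero.mpr hxk)) 2)
  rw [← regularizedPotential_zero hpole, regularizedPotential, Fintype.card_fin]
  linarith

theorem hardyConstant_le (hN : 3 ≤ N) (hn : 2 ≤ n) (ha : Function.Injective a) {k : Fin n}
    (hk : a k ∈ Ω) :
    hardyConstant Ω a ≤ ENNReal.ofReal (((N : ℝ) - 2) ^ 2 / (4 * (n : ℝ) - 4)) := by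
  have hn' : (0 : ℝ) < (n : ℝ) - 1 := by
    have : (2 : ℝ) ≤ n := by exact_mod_cast hn
    linarith
  have hlim : Tendsto (fun c => hardyConstant Ω a * ENNReal.ofReal c) (𝓝[<] ((n : ℝ) - 1))
      (𝓝 (hardyConstant Ω a * ENNReal.ofReal ((n : ℝ) - 1))) :=
    ENNReal.Tendsto.const_mul ((ENNReal.continuous_ofReal.tendsto _).mono_left nhdsWithin_le_nhds)
      (Or.inl (ENNReal.ofReal_ne_zero_iff.mpr hn'))
  have hmul : hardyConstant Ω a * ENNReal.ofReal ((n : ℝ) - 1)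
      ≤ ENNReal.ofReal (((N : ℝ) - 2) ^ 2 / 4) := by
    refine le_of_tendsto hlim ?_
    filter_upwards [Ioo_mem_nhdsLT hn'] with c hc
    refine hardyConstant_mul_le_of_eventually_le_potential hN hk hc.1.le ?_
    simpa using eventually_mul_inv_norm_sub_sq_le_potential ha k (sub_pos.mpr hc.2)
  calc hardyConstant Ω a
      ≤ ENNReal.ofReal (((N : ℝ) - 2) ^ 2 / 4) / ENNReal.ofReal ((n : ℝ) - 1) :=
        (ENNReal.le_div_iff_mul_le (Or.inl (ENNReal.ofReal_ne_zero_iff.mpr hn'))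
          (Or.inl ENNReal.ofReal_ne_top)).mpr hmul
    _ = ENNReal.ofReal (((N : ℝ) - 2) ^ 2 / (4 * (n : ℝ) - 4)) := by
        rw [← ENNReal.ofReal_div_of_pos hn', div_div, mul_sub_one]

end UpperBound

end MultipolarHardy

end

theorem theorem1_general (N n : ℕ) (hN : 3 ≤ N)
    (Ω : TopologicalSpace.Opens (EuclideanSpace ℝ (Fin N)))
    (a : Fin n → EuclideanSpace ℝ (Fin N)) (ha : Function.Injective a) (haΩ : ∃ i, a i ∈ Ω) :
    (n = 2 →
      MultipolarHardy.hardyConstant Ω a = ENNReal.ofReal (((N : ℝ) - 2) ^ 2 / 4)) ∧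
    (3 ≤ n →
      (Bornology.IsBounded (Ω : Set (EuclideanSpace ℝ (Fin N))) →
        ENNReal.ofReal (((N : ℝ) - 2) ^ 2 / (n : ℝ) ^ 2) < MultipolarHardy.hardyConstant Ω a) ∧
      MultipolarHardy.hardyConstant Ω a ≤
        ENNReal.ofReal (((N : ℝ) - 2) ^ 2 / (4 * (n : ℝ) - 4))) := by
  obtain ⟨k, hk⟩ := haΩ
  refine ⟨?_, fun hn => ⟨fun hΩ => MultipolarHardy.lt_hardyConstant hN hn hΩ ha,
    MultipolarHardy.hardyConstant_le hN (by omega) ha hk⟩⟩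
  rintro rfl
  exact le_antisymm ((MultipolarHardy.hardyConstant_le hN le_rfl ha hk).trans_eq (by norm_num))
    (le_of_eq_of_le (by norm_num) (MultipolarHardy.le_hardyConstant hN le_rfl Ω ha))

theorem theorem1 (N n : ℕ) (hN : 3 ≤ N)
    (Ω : TopologicalSpace.Opens (EuclideanSpace ℝ (Fin N)))
    (a : Fin n → EuclideanSpace ℝ (Fin N)) (ha : Function.Injective a) (haΩ : ∀ i, a i ∈ Ω) :
    (n = 2 →
      MultipolarHardy.hardyConstant Ω a = ENNReal.ofReal (((N : ℝ) - 2) ^ 2 / 4)) ∧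
    (3 ≤ n → Bornology.IsBounded (Ω : Set (EuclideanSpace ℝ (Fin N))) →
      ENNReal.ofReal (((N : ℝ) - 2) ^ 2 / (n : ℝ) ^ 2) < MultipolarHardy.hardyConstant Ω a ∧
      MultipolarHardy.hardyConstant Ω a ≤
        ENNReal.ofReal (((N : ℝ) - 2) ^ 2 / (4 * (n : ℝ) - 4))) := by
  have h (hn : 2 ≤ n) := theorem1_general N n hN Ω a ha ⟨⟨0, by omega⟩, haΩ _⟩
  exact ⟨fun hn => (h hn.ge).1 hn, fun hn hΩ => ((h (by omega)).2 hn).imp_left (· hΩ)⟩
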